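/- Let $k\ge 1$ and $1\le i\le k$ be integers, and let $n,m\ge 0$ be integers. Let $F_{k,i}(n,m)$ be the number of partitions $p=(p_1\ge p_2\ge\dots\ge p_m\ge 1)$ of $n$ into exactly $m$ parts such that $p_l\ge p_{l+k-1}+2$ for all $l$ with $1\le l\le m-k+1$, and $p_{m-i+1}\ge 2$ if $m\ge i$ (that is, at most $i-1$ parts are equal to $1$). Let $G_{k,i}(n,m)$ be the number of $(k-1)$-tuples $(n^{(1)},\dots,n^{(k-1)})$ of (possibly empty) partitions $n^{(j)}=(n^{(j)}_1,\dots,n^{(j)}_{m_j})$, with $m_j\ge 0$ parts, such that for every $1\le j\le k-1$ $$n^{(j)}_\ell\ \ge\ n^{(j)}_{\ell+1}+2j\qquad(1\le \ell<m_j),$$ $$n^{(j)}_{m_j}\ \ge\ j+\max(j-i+1,0)+2j\,(m_{j+1}+\dots+m_{k-1})\qquad\text{if } m_j\ge 1,$$ and such that $$\sum_{j=1}^{k-1}\sum_{\ell=1}^{m_j}n^{(j)}_\ell=n,\qquad \sum_{j=1}^{k-1}j\,m_j=m.$$ Then $F_{k,i}(n,m)=G_{k,i}(n,m)$. Moreover,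 a partition satisfies the conditions defining $F_{k,i}$ if and only if $f_j+f_{j+1}\le k-1$ for all $j\ge 1$ and $f_1\le i-1$, where $f_j$ denotes the number of its parts equal to $j$. -/

import Mathlib

namespace BurgeBressoud

/-- The parts `(p₁, …, pₘ)` of a partition, listed in non-increasing order. The part `p_l` of the
usual one-based numbering is the entry `(seq p)[l - 1]`. -/
def seq {n : ℕ} (p : n.Partition) : List ℕ :=
  p.parts.sort (· ≥ ·)

/-- "Difference `2` at distance `k - 1`", `p_l ≥ p_{l+k-1} + 2` whenever both parts exist, and
`p_{m-i+1} ≥ 2` whenever this part exists. (The requirement `p_m ≥ 1` is part of `Nat.Partition`.)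
In zero-based numbering `p_{m-i+1}` is the entry with index `m - i`, and it exists iff `i ≤ m`
(for `i ≥ 1`). -/
def DiffCond (k i : ℕ) {n : ℕ} (p : n.Partition) : Prop :=
  (∀ l, ∀ _ : l + (k - 1) < (seq p).length, (seq p)[l + (k - 1)] + 2 ≤ (seq p)[l]) ∧
  (∀ _ : i ≤ (seq p).length, ∀ _ : (seq p).length - i < (seq p).length,
    2 ≤ (seq p)[(seq p).length - i])

/-- The frequency condition: `f_j + f_{j+1} ≤ k - 1` for all `j ≥ 1`, and `f_1 ≤ i - 1`, where
`f_j` is the number of parts equal to `j`. -/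
def FreqCond (k i : ℕ) {n : ℕ} (p : n.Partition) : Prop :=
  (∀ j, 1 ≤ j → p.parts.count j + p.parts.count (j + 1) ≤ k - 1) ∧ p.parts.count 1 ≤ i - 1

/-- `F_{k,i}(n,m)`: the number of partitions of `n` into `m` parts satisfying `DiffCond k i`. -/
noncomputable def F (k i n m : ℕ) : ℕ :=
  {p : n.Partition | p.parts.card = m ∧ DiffCond k i p}.ncard

/-- A multiple partition `(n^{(1)}, …, n^{(k-1)})`: a `(k-1)`-tuple of partitions of arbitrary
weights. The index `a : Fin (k - 1)` stands for the charge `j = a + 1`. -/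
abbrev MultiPartition (k : ℕ) : Type :=
  Fin (k - 1) → (w : ℕ) × w.Partition

namespace MultiPartition

variable {k : ℕ}

/-- The parts of `n^{(j)}`, `j = a + 1`, in non-increasing order. -/
def partsAt (P : MultiPartition k) (a : Fin (k - 1)) : List ℕ :=
  seq (P a).2

/-- The number of parts `m_j` of `n^{(j)}`, `j = a + 1`. -/
def len (P : MultiPartition k) (a : Fin (k - 1)) : ℕ :=
  (P.partsAt a).length

/-- The total weight: the sum of all parts of all the `n^{(j)}`. -/
def weight (P : MultiPartition k) : ℕ :=
  ∑ a, (P.partsAt a).sum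

/-- The total charge `∑_j j m_j`. -/
def charge (P : MultiPartition k) : ℕ :=
  ∑ a : Fin (k - 1), (a.val + 1) * P.len a

/-- The bound `Δ_{(i;j)} = j + max (j - i + 1, 0) + 2 j (m_{j+1} + ⋯ + m_{k-1})` with `j = a + 1`.
The truncated subtraction `j + 1 - i` of natural numbers is `max (j - i + 1, 0)`. -/
def bound (i : ℕ) (P : MultiPartition k) (a : Fin (k - 1)) : ℕ :=
  (a.val + 1) + ((a.val + 1) + 1 - i) + 2 * (a.val + 1) * ∑ b ∈ Finset.Ioi a, P.len b

/-- For every `j = a + 1`: `n^{(j)}_ℓ ≥ n^{(j)}_{ℓ+1} + 2j` for consecutive parts of `n^{(j)}`, and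
the smallest part of `n^{(j)}` (if there is one) is at least `Δ_{(i;j)}`. -/
def Admissible (i : ℕ) (P : MultiPartition k) : Prop :=
  ∀ a : Fin (k - 1),
    (∀ l, ∀ _ : l + 1 < (P.partsAt a).length,
      (P.partsAt a)[l + 1] + 2 * (a.val + 1) ≤ (P.partsAt a)[l]) ∧
    (∀ h : P.partsAt a ≠ [], P.bound i a ≤ (P.partsAt a).getLast h)

end MultiPartition

/-- The multiple partitions of weight `n` and charge `m` counted by `G_{k,i}(n,m)`. -/
def GSet (k i n m : ℕ) : Set (MultiPartition k) :=
  {P | P.weight = n ∧ P.charge = m ∧ P.Admissible i}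

/-- `G_{k,i}(n,m)`: the number of multiple partitions `(n^{(1)}, …, n^{(k-1)})` of total weight `n`
and total charge `m` satisfying the difference conditions and the lower bounds. -/
noncomputable def G (k i n m : ℕ) : ℕ :=
  (GSet k i n m).ncard

/-- The set counted by `G` is finite, so that `Set.ncard` is its honest number of elements. -/
theorem GSet_finite (k i n m : ℕ) : (GSet k i n m).Finite := by
  have hfin : Finite {x : (w : ℕ) × w.Partition | x.1 ≤ n} := by
    refine Finite.of_injective
      (β := (w : Fin (n + 1)) × (w.val).Partition)
      (fun x => ⟨⟨x.1.1, Nat.lt_succ_of_le x.2⟩, x.1.2⟩) ?_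
    rintro ⟨⟨w, p⟩, hw⟩ ⟨⟨w', p'⟩, hw'⟩ h
    simp only [Sigma.mk.injEq, Fin.mk.injEq] at h
    obtain ⟨rfl, h⟩ := h
    simpa using h
  refine (Set.Finite.pi' (fun _ : Fin (k - 1) => Set.toFinite
    {x : (w : ℕ) × w.Partition | x.1 ≤ n})).subset ?_
  rintro (P : MultiPartition k) ⟨hP, -, -⟩ a
  have h1 : (P.partsAt a).sum = (P a).1 := by
    have h2 : ((P.partsAt a : List ℕ) : Multiset ℕ).sum = (P a).2.parts.sum := by
      simp [MultiPartition.partsAt, seq]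
    rw [Multiset.sum_coe, (P a).2.parts_sum] at h2
    exact h2
  have h3 : (P.partsAt a).sum ≤ P.weight :=
    Finset.single_le_sum (f := fun b => (P.partsAt b).sum) (fun _ _ => Nat.zero_le _)
      (Finset.mem_univ a)
  change (P a).1 ≤ n
  omega

end BurgeBressoud

namespace BurgeBressoud

open PowerSeries

/-! Fix the number of parts (or charge) `m` and put `K = k - 1`. Both counts are coefficients of one
power series in `q`, the coefficient `multiSum K i m` of `x ^ m` in the Andrews–Gordon multiple sum.

On the partition side, split according to whether `f_1` takes its maximal value `a = i - 1`. If not,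
the partition is counted with `i - 1` in place of `i`. If it does, delete the ones and subtract `1`
from the other parts: the weight drops by `m`, the number of parts by `a`, and the old bound `f_1 +
f_2 ≤ k - 1` becomes a bound on the new `f_1`. This recurrence (`genSeries_freqMultisets_succ`) and
the initial values determine the series. `multiSum_recurrence` shows, by a telescoping argument,
that `multiSum` satisfies it too.

On the tuple side, split off the component of largest charge. Its parts form a list with fixed
minimal differences, whose series is a monomial times `qInv r` (`genSeries_spacedLists`). Its length
raises the bounds of all remaining components, which contributes only a power of `q`. Iterating
gives exactly the defining recursion of `multiSum` (`genSeries_spacedTuples`).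

The equivalence of the difference and frequency conditions is a separate argument, by counting the
parts that are at least a given value. -/

/-! ### The multiple sum and its functional equation -/

/-- The series `1 / ((1 - q) (1 - q²) ⋯ (1 - q^r))`. -/
noncomputable def qInv (r : ℕ) : ℚ⟦X⟧ :=
  (∏ j ∈ Finset.range r, (1 - X ^ (j + 1) : ℚ⟦X⟧))⁻¹

theorem qInv_zero : qInv 0 = 1 := by simp [qInv]

theorem one_sub_mul_qInv_succ (r : ℕ) : (1 - X ^ (r + 1)) * qInv (r + 1) = qInv r := by
  have h : constantCoeff (1 - X ^ (r + 1) : ℚ⟦X⟧) ≠ 0 := by simp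
  rw [qInv, Finset.prod_range_succ, PowerSeries.mul_inv_rev, ← mul_assoc,
    PowerSeries.mul_inv_cancel _ h, one_mul, qInv]

/-- The coefficient of `x ^ m` in the multiple sum
`∑ x ^ (N₁ + ⋯ + N_K) q ^ (N₁² + ⋯ + N_K² + N_i + ⋯ + N_K) / ((q)_{N₁ - N₂} ⋯ (q)_{N_K})`,
written as an iterated sum over `r = N_K`; it is set to `0` for `i = 0`. -/
noncomputable def multiSum : ℕ → ℕ → ℕ → ℚ⟦X⟧
  | _, 0, _ => 0
  | 0, _ + 1, m => if m = 0 then 1 else 0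
  | K + 1, i + 1, m => ∑ r ∈ Finset.range (m + 1),
      if (K + 1) * r ≤ m then
        X ^ ((K + 1) * r ^ 2 + (K + 1 - i) * r + 2 * r * (m - (K + 1) * r)) * qInv r *
          multiSum K (i + 1) (m - (K + 1) * r)
      else 0

theorem multiSum_index_zero (K m : ℕ) : multiSum K 0 m = 0 := by
  cases K <;> simp [multiSum]

/-- The summand of `multiSum (K + 1) i m` with index `r`. -/
noncomputable def multiSumTerm (K i m r : ℕ) : ℚ⟦X⟧ :=
  if (K + 1) * r ≤ m then
    X ^ ((K + 1) * r ^ 2 + (K + 2 - i) * r + 2 * r * (m - (K + 1) * r)) * qInv r *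
      multiSum K i (m - (K + 1) * r)
  else 0

theorem multiSumTerm_of_lt {K i m r : ℕ} (h : m < r) : multiSumTerm K i m r = 0 := by
  rw [multiSumTerm, if_neg]
  nlinarith

theorem multiSum_succ (K i m N : ℕ) (hN : m < N) :
    multiSum (K + 1) i m = ∑ r ∈ Finset.range N, multiSumTerm K i m r := by
  have h : multiSum (K + 1) i m = ∑ r ∈ Finset.range (m + 1), multiSumTerm K i m r := by
    cases i with
    | zero => simp [multiSumTerm, multiSum_index_zero]
    | succ i => simp [multiSum, multiSumTerm]
  rw [h]
  refine Finset.sum_subset (Finset.range_subset_range.2 hN) fun r _ hr => ?_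
  exact multiSumTerm_of_lt (by simpa using hr)

theorem multiSum_of_lt (K : ℕ) : ∀ i m, K < i → multiSum K i m = multiSum K (K + 1) m := by
  induction K with
  | zero => intro i m h; obtain ⟨i, rfl⟩ := Nat.exists_eq_add_of_lt h; simp [multiSum]
  | succ K ih =>
    intro i m h
    rw [multiSum_succ K _ _ _ (Nat.lt_succ_self m), multiSum_succ K _ _ _ (Nat.lt_succ_self m)]
    refine Finset.sum_congr rfl fun r _ => ?_
    rw [multiSumTerm, multiSumTerm, ih i _ (by omega), ih (K + 1 + 1) _ (by omega),
      show K + 2 - i = 0 by omega, show K + 2 - (K + 1 + 1) = 0 by omega]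

theorem multiSum_zero {i : ℕ} (hi : 0 < i) (K : ℕ) : multiSum K i 0 = 1 := by
  induction K with
  | zero => obtain ⟨i, rfl⟩ := Nat.exists_eq_succ_of_ne_zero hi.ne'; simp [multiSum]
  | succ K ih =>
    rw [multiSum_succ K i 0 1 (by simp)]
    simp [multiSumTerm, qInv_zero, ih]

/-- The functional equation of `multiSum`, extended by the case `b = 0`. -/
theorem multiSum_recurrence (K : ℕ) : ∀ a b m, a + b = K + 1 →
    multiSum K (a + 1) m =
      multiSum K a m + if a ≤ m then X ^ m * multiSum K b (m - a) else 0 := by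
  induction K with
  | zero =>
    intro a b m h
    obtain ⟨rfl, rfl⟩ | ⟨rfl, rfl⟩ : a = 0 ∧ b = 1 ∨ a = 1 ∧ b = 0 := by omega
    · by_cases hm : m = 0 <;> simp [multiSum, hm]
    · simp [multiSum]
  | succ K ih =>
    intro a b m h
    cases b with
    | zero =>
      obtain rfl : a = K + 2 := by omega
      simp [multiSum_index_zero, multiSum_of_lt (K + 1) (K + 2 + 1) m (by omega)]
    | succ c =>
      have hac : a + c = K + 1 := by omega
      -- `A` comes from `q^(c r) = q^((c+1) r) + q^(c r) (1 - q^r)`, and `B` from the induction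
      -- hypothesis for `(a, c)`. On the other side, the hypothesis for `(c, a)` gives `B r` and a
      -- term that is `A` at `r + 1`, since `1 - q^(r+1)` cancels a factor of `qInv (r + 1)`. The
      -- two sums then differ only by the boundary values of `A`, which vanish.
      set A : ℕ → ℚ⟦X⟧ := fun r => if (K + 1) * r ≤ m then
        X ^ ((K + 1) * r ^ 2 + c * r + 2 * r * (m - (K + 1) * r)) * ((1 - X ^ r) * qInv r) *
          multiSum K a (m - (K + 1) * r) else 0 with hA
      set B : ℕ → ℚ⟦X⟧ := fun r => if (K + 1) * r + a ≤ m then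
        X ^ ((K + 1) * r ^ 2 + c * r + (2 * r + 1) * (m - (K + 1) * r)) * qInv r *
          multiSum K c (m - (K + 1) * r - a) else 0 with hB
      have h1 : ∀ r, multiSumTerm K (a + 1) m r = multiSumTerm K a m r + A r + B r := by
        intro r
        simp only [multiSumTerm, hA, hB, show K + 2 - (a + 1) = c by omega,
          show K + 2 - a = c + 1 by omega]
        by_cases hr : (K + 1) * r ≤ m
        · obtain ⟨m', rfl⟩ := Nat.exists_eq_add_of_le hr
          simp only [hr, if_true, Nat.add_sub_cancel_left, ih a c m' hac, add_le_add_iff_left]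
          split_ifs <;> ring
        · rw [if_neg hr, if_neg hr, if_neg hr, if_neg (by omega)]
          simp
      have h2 : ∀ r, (if a ≤ m then X ^ m * multiSumTerm K (c + 1) (m - a) r else 0) =
          B r + A (r + 1) := by
        intro r
        simp only [multiSumTerm, hA, hB, one_sub_mul_qInv_succ, show K + 2 - (c + 1) = a by omega]
        by_cases hr : (K + 1) * r + a ≤ m
        · obtain ⟨m', rfl⟩ := Nat.exists_eq_add_of_le hr
          rw [if_pos (by omega), if_pos (by omega), if_pos hr,
            show (K + 1) * r + a + m' - a - (K + 1) * r = m' by omega,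
            show (K + 1) * r + a + m' - (K + 1) * r = a + m' by omega, Nat.add_sub_cancel_left,
            ih c a m' (by omega)]
          have hK : (K + 1) * (r + 1) = (K + 1) * r + a + c := by rw [add_assoc, hac]; ring
          by_cases hc : c ≤ m'
          · obtain ⟨m', rfl⟩ := Nat.exists_eq_add_of_le hc
            rw [if_pos hc, if_pos (by omega), Nat.add_sub_cancel_left,
              show (K + 1) * r + a + (c + m') - (K + 1) * (r + 1) = m' by omega, ← hac]
            ring
          · rw [if_neg hc, if_neg (by omega), ← hac]
            ring
        · have hK : (K + 1) * (r + 1) = (K + 1) * r + a + c := by rw [add_assoc, hac]; ring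
          rw [if_neg hr, if_neg (show ¬ (K + 1) * (r + 1) ≤ m by omega)]
          split_ifs
          · omega
          · simp
          · simp
      have hA0 : A 0 = 0 := by simp [hA]
      have hAm : A (m + 1) = 0 := by
        simp only [hA]
        rw [if_neg]
        nlinarith
      have h3 : (if a ≤ m then X ^ m * multiSum (K + 1) (c + 1) (m - a) else 0) =
          ∑ r ∈ Finset.range (m + 1), (B r + A (r + 1)) := by
        simp only [← h2]
        split_ifs
        · rw [← Finset.mul_sum, ← multiSum_succ K _ _ _ (by omega)]
        · simp
      rw [h3, multiSum_succ K _ _ _ (Nat.lt_succ_self m), multiSum_succ K _ _ _ (Nat.lt_succ_self m)]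
      simp only [h1, Finset.sum_add_distrib]
      have h4 := Finset.sum_range_succ' A (m + 1)
      rw [Finset.sum_range_succ, hA0, hAm] at h4
      linear_combination h4

/-! ### Generating series by weight -/

theorem ncard_eq_sum_ncard_fiber {α β : Type*} {U : Set α} (hU : U.Finite) (f : α → β)
    (t : Finset β) (hf : ∀ x ∈ U, f x ∈ t) : U.ncard = ∑ b ∈ t, {x ∈ U | f x = b}.ncard := by
  classical
  obtain ⟨U, rfl⟩ := hU.exists_finset_coe
  rw [Set.ncard_coe_finset, Finset.card_eq_sum_card_fiberwise (t := t) hf]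
  refine Finset.sum_congr rfl fun b _ => ?_
  rw [← Set.ncard_coe_finset]
  congr 1
  ext x
  simp

/-- The generating series of the elements of `S` by weight. -/
noncomputable def genSeries {α : Type*} (S : Set α) (w : α → ℕ) : ℚ⟦X⟧ :=
  PowerSeries.mk fun n => ({x ∈ S | w x = n}.ncard : ℚ)

theorem coeff_genSeries {α : Type*} (S : Set α) (w : α → ℕ) (n : ℕ) :
    coeff n (genSeries S w) = ({x ∈ S | w x = n}.ncard : ℚ) := by
  simp [genSeries]

theorem genSeries_eq_sum {α β : Type*} {S : Set α} {w : α → ℕ}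
    (hS : ∀ n, {x ∈ S | w x = n}.Finite) (f : α → β) (t : Finset β) (hf : ∀ x ∈ S, f x ∈ t) :
    genSeries S w = ∑ b ∈ t, genSeries {x ∈ S | f x = b} w := by
  ext n
  rw [map_sum]
  simp only [coeff_genSeries]
  rw [ncard_eq_sum_ncard_fiber (hS n) f t fun x hx => hf x hx.1]
  push_cast
  refine Finset.sum_congr rfl fun b _ => ?_
  congr 2
  ext x
  simp only [Set.mem_ofPred_eq]
  tauto

theorem genSeries_prod {α β : Type*} {S : Set α} {T : Set β} {w : α → ℕ} {v : β → ℕ}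
    (hS : ∀ n, {x ∈ S | w x = n}.Finite) (hT : ∀ n, {x ∈ T | v x = n}.Finite) :
    genSeries (S ×ˢ T) (fun x => w x.1 + v x.2) = genSeries S w * genSeries T v := by
  ext n
  have hfiber : ∀ b : ℕ × ℕ, b.1 + b.2 = n →
      {x ∈ {x ∈ S ×ˢ T | w x.1 + v x.2 = n} | (w x.1, v x.2) = b} =
        {x ∈ S | w x = b.1} ×ˢ {x ∈ T | v x = b.2} := by
    rintro ⟨b, c⟩ h
    ext x
    simp only [Set.mem_ofPred_eq, Set.mem_prod, Prod.mk.injEq] at *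
    constructor
    · tauto
    · rintro ⟨⟨h1, h2⟩, h3, h4⟩
      exact ⟨⟨⟨h1, h3⟩, by omega⟩, h2, h4⟩
  have hfin : {x ∈ S ×ˢ T | w x.1 + v x.2 = n}.Finite := by
    refine Set.Finite.subset (Set.Finite.biUnion (Finset.HasAntidiagonal.antidiagonal n).finite_toSet
      fun b _ => (hS b.1).prod (hT b.2)) fun x hx => ?_
    simp only [Set.mem_iUnion]
    exact ⟨(w x.1, v x.2), by simpa using hx.2, ⟨hx.1.1, rfl⟩, ⟨hx.1.2, rfl⟩⟩
  simp only [coeff_mul, coeff_genSeries]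
  rw [ncard_eq_sum_ncard_fiber hfin (fun x => (w x.1, v x.2)) (Finset.HasAntidiagonal.antidiagonal n)
    fun x hx => by simpa using hx.2]
  push_cast
  refine Finset.sum_congr rfl fun b hb => ?_
  rw [hfiber b (by simpa using hb), Set.ncard_prod]
  push_cast
  rfl

theorem genSeries_bijOn {α β : Type*} {S : Set α} {T : Set β} {w : α → ℕ} {v : β → ℕ} (f : α → β)
    (c : ℕ) (hf : Set.BijOn f S T) (hw : ∀ x ∈ S, v (f x) = w x + c) :
    genSeries T v = X ^ c * genSeries S w := by
  ext n
  rw [coeff_X_pow_mul']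
  simp only [coeff_genSeries]
  split_ifs with h
  · congr 1
    refine (Set.BijOn.ncard_eq (f := f) ⟨?_, hf.injOn.mono fun x hx => hx.1, ?_⟩).symm
    · intro x hx
      exact ⟨hf.mapsTo hx.1, by have := hw x hx.1; have := hx.2; omega⟩
    · rintro y ⟨hy, hn⟩
      obtain ⟨x, hx, rfl⟩ := hf.surjOn hy
      exact ⟨x, ⟨hx, by have := hw x hx; omega⟩, rfl⟩
  · rw [Nat.cast_eq_zero]
    convert Set.ncard_empty β
    rw [Set.eq_empty_iff_forall_notMem]
    rintro y ⟨hy, hn⟩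
    obtain ⟨x, hx, rfl⟩ := hf.surjOn hy
    have := hw x hx
    omega

theorem genSeries_empty {α : Type*} (w : α → ℕ) : genSeries (∅ : Set α) w = 0 := by
  ext n; simp [coeff_genSeries]

theorem genSeries_singleton {α : Type*} (x : α) {w : α → ℕ} (hw : w x = 0) :
    genSeries {x} w = 1 := by
  ext n
  rw [coeff_genSeries, coeff_one]
  split_ifs with h
  · have : {y ∈ ({x} : Set α) | w y = n} = {x} := by ext y; simp; rintro rfl; omega
    rw [this]; simp
  · have : {y ∈ ({x} : Set α) | w y = n} = ∅ := by ext y; simp; rintro rfl; omega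
    rw [this]; simp

/-! ### Lists with prescribed minimal differences -/

theorem finite_setOf_length_le_sum_le (m n : ℕ) :
    {l : List ℕ | l.length ≤ m ∧ l.sum ≤ n}.Finite := by
  refine ((List.finite_length_le (Fin (n + 1)) m).image (List.map Fin.val)).subset ?_
  rintro l ⟨h1, h2⟩
  refine ⟨l.pmap (fun x hx => ⟨x, hx⟩) fun x hx => ?_, ?_, ?_⟩
  · have := List.le_sum_of_mem hx
    omega
  · simpa using h1
  · simp [List.map_pmap]

/-- The list is increasing with differences at least `d`, and its first entry is at least `b`. -/
def Spaced (d : ℕ) : ℕ → List ℕ → Prop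
  | _, [] => True
  | b, x :: l => b ≤ x ∧ Spaced d (x + d) l

theorem spaced_map_succ (d b : ℕ) (l : List ℕ) :
    Spaced d (b + 1) (l.map (· + 1)) ↔ Spaced d b l := by
  induction l generalizing b with
  | nil => simp [Spaced]
  | cons x l ih =>
    simp only [Spaced, List.map_cons, add_le_add_iff_right]
    rw [← ih, Nat.add_right_comm]

theorem Spaced.le_of_mem {d b : ℕ} {l : List ℕ} (h : Spaced d b l) {x : ℕ} (hx : x ∈ l) :
    b ≤ x := by
  induction l generalizing b with
  | nil => simp at hx
  | cons y l ih =>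
    rcases List.mem_cons.1 hx with rfl | hx
    · exact h.1
    · have := ih h.2 hx
      have := h.1
      omega

theorem spaced_iff_isChain (d b : ℕ) (l : List ℕ) :
    Spaced d b l ↔ l.IsChain (fun x y => x + d ≤ y) ∧ ∀ x ∈ l.head?, b ≤ x := by
  induction l generalizing b with
  | nil => simp [Spaced]
  | cons x l ih =>
    rw [Spaced, ih, List.isChain_cons]
    simp
    tauto

/-- Lists of length `r` with differences at least `d` and entries at least `b`. -/
def spacedLists (d b r : ℕ) : Set (List ℕ) :=
  {l | Spaced d b l ∧ l.length = r}

theorem spacedLists_finite (d b r n : ℕ) : {l ∈ spacedLists d b r | l.sum = n}.Finite :=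
  (finite_setOf_length_le_sum_le r n).subset fun _ h => ⟨h.1.2.le, h.2.le⟩

theorem genSeries_spacedLists_add_one (d b r : ℕ) :
    genSeries (spacedLists d (b + 1) r) List.sum =
      X ^ r * genSeries (spacedLists d b r) List.sum := by
  refine genSeries_bijOn (List.map (· + 1)) r ⟨?_, ?_, ?_⟩ ?_
  · rintro l ⟨h1, h2⟩
    exact ⟨(spaced_map_succ d b l).2 h1, by simpa using h2⟩
  · exact (List.map_injective_iff.2 (add_left_injective 1)).injOn
  · rintro l ⟨h1, h2⟩
    have h : (l.map (· - 1)).map (· + 1) = l := by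
      rw [List.map_map]
      conv_rhs => rw [← List.map_id l]
      refine List.map_congr_left fun x hx => ?_
      have := h1.le_of_mem hx
      simp only [Function.comp_apply, id]
      omega
    refine ⟨l.map (· - 1), ⟨?_, by simpa using h2⟩, h⟩
    rwa [← spaced_map_succ, h]
  · rintro l ⟨-, rfl⟩
    clear * -
    induction l with
    | nil => simp
    | cons x l ih => simp only [List.map_cons, List.sum_cons, ih, List.length_cons]; ring

theorem genSeries_spacedLists_add (d b c r : ℕ) :
    genSeries (spacedLists d (b + c) r) List.sum =
      X ^ (c * r) * genSeries (spacedLists d b r) List.sum := by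
  induction c with
  | zero => simp
  | succ c ih => rw [← add_assoc, genSeries_spacedLists_add_one, ih]; ring

/-- Either the first entry is `b`, and removing it raises the lower bound to `b + d`, or every entry
is at least `b + 1`. -/
theorem genSeries_spacedLists_succ (d b r : ℕ) :
    genSeries (spacedLists d b (r + 1)) List.sum =
      X ^ b * genSeries (spacedLists d (b + d) r) List.sum +
        genSeries (spacedLists d (b + 1) (r + 1)) List.sum := by
  classical
  rw [genSeries_eq_sum (spacedLists_finite d b (r + 1)) (fun l => decide (l.head? = some b))
    Finset.univ (fun _ _ => Finset.mem_univ _), Fintype.sum_bool]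
  congr 1
  · refine genSeries_bijOn (List.cons b) b ⟨?_, ?_, ?_⟩ ?_
    · rintro l ⟨h1, h2⟩
      exact ⟨⟨⟨le_rfl, h1⟩, by simpa using h2⟩, by simp⟩
    · exact (List.cons_injective).injOn
    · rintro (_ | ⟨x, l⟩) ⟨⟨h1, h2⟩, h3⟩
      · simp at h2
      · obtain rfl : x = b := by simpa using h3
        exact ⟨l, ⟨h1.2, by simpa using h2⟩, rfl⟩
    · intro l _
      rw [List.sum_cons, add_comm]
  · congr 1
    ext l
    rcases l with _ | ⟨x, l⟩
    · simp [spacedLists]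
    · simp only [spacedLists, Spaced, Set.mem_ofPred_eq, List.head?_cons, Option.some.injEq,
        decide_eq_false_iff_not]
      constructor
      · rintro ⟨⟨⟨h1, h2⟩, h3⟩, h4⟩
        exact ⟨⟨by omega, h2⟩, h3⟩
      · rintro ⟨⟨h1, h2⟩, h3⟩
        exact ⟨⟨⟨by omega, h2⟩, h3⟩, by omega⟩

/-- The minimal list `b, b + 2j, …` has sum `j r² - j r + b r`; the factor `X ^ (j * r)` avoids the
subtraction. -/
theorem genSeries_spacedLists (j b r : ℕ) :
    X ^ (j * r) * genSeries (spacedLists (2 * j) b r) List.sum =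
      X ^ (j * r ^ 2 + b * r) * qInv r := by
  induction r with
  | zero =>
    have : spacedLists (2 * j) b 0 = {[]} := by
      ext l
      simp only [spacedLists, Set.mem_ofPred_eq, List.length_eq_zero_iff, Set.mem_singleton_iff]
      exact ⟨And.right, by rintro rfl; simp [Spaced]⟩
    rw [this, genSeries_singleton _ (by simp)]
    simp [qInv_zero]
  | succ r ih =>
    have h := genSeries_spacedLists_succ (2 * j) b r
    rw [genSeries_spacedLists_add_one, genSeries_spacedLists_add] at h
    have hne : (1 - X ^ (r + 1) : ℚ⟦X⟧) ≠ 0 := fun h0 => by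
      have := congrArg constantCoeff h0
      simp at this
    refine mul_left_cancel₀ hne ?_
    have hq := one_sub_mul_qInv_succ r
    -- In `h` the lists bounded by `b + 1` are a shift of those bounded by `b`, so `h` expresses `1
    -- - X ^ (r + 1)` times the unknown series through length `r`.
    linear_combination X ^ (j * (r + 1)) * h + X ^ (j + b + 2 * j * r) * ih -
      X ^ (j * (r + 1) ^ 2 + b * (r + 1)) * hq

/-! ### The tuple side -/

/-- Tuples of spaced lists subject to the lower bounds of `MultiPartition.Admissible`, with all the
sums `m_{j+1} + ⋯` increased by `s`, of charge `m`. -/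
def spacedTuples (K i s m : ℕ) : Set (Fin K → List ℕ) :=
  {P | (∀ a, Spaced (2 * (a.val + 1)) ((a.val + 1) + ((a.val + 1) + 1 - i) +
      2 * (a.val + 1) * (∑ b ∈ Finset.Ioi a, (P b).length + s)) (P a)) ∧
    ∑ a : Fin K, (a.val + 1) * (P a).length = m}

theorem spacedTuples_finite (K i s m n : ℕ) :
    {P ∈ spacedTuples K i s m | ∑ a, (P a).sum = n}.Finite := by
  refine (Set.Finite.pi' fun _ : Fin K => finite_setOf_length_le_sum_le m n).subset ?_
  rintro P ⟨⟨-, h1⟩, h2⟩ a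
  constructor
  · rw [← h1]
    exact (Nat.le_mul_of_pos_left _ a.val.succ_pos).trans (Finset.single_le_sum
      (f := fun a : Fin K => (a.val + 1) * (P a).length) (fun _ _ => Nat.zero_le _)
      (Finset.mem_univ a))
  · rw [← h2]
    exact Finset.single_le_sum (f := fun a : Fin K => (P a).sum) (fun _ _ => Nat.zero_le _)
      (Finset.mem_univ a)

theorem sum_Ioi_castSucc {K : ℕ} (a : Fin K) (f : Fin (K + 1) → ℕ) :
    ∑ b ∈ Finset.Ioi a.castSucc, f b = ∑ b ∈ Finset.Ioi a, f b.castSucc + f (Fin.last K) := by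
  have h : ∀ {N : ℕ} (a : Fin N) (f : Fin N → ℕ),
      ∑ b ∈ Finset.Ioi a, f b = ∑ b, if a < b then f b else 0 := fun a f => by
    rw [← Finset.sum_filter]
    congr 1
    ext b
    simp
  rw [h, h, Fin.sum_univ_castSucc]
  simp [Fin.castSucc_lt_last]

/-- The last component has the largest charge, so its own bound involves only `s`, while its length
enters the bound of every other component; the offset `s` absorbs it. -/
theorem snoc_mem_spacedTuples {K i s m : ℕ} (l : List ℕ) (P : Fin K → List ℕ) :
    (Fin.snoc P l : Fin (K + 1) → List ℕ) ∈ spacedTuples (K + 1) i s m ↔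
      Spaced (2 * (K + 1)) (K + 1 + (K + 2 - i) + 2 * (K + 1) * s) l ∧
        (K + 1) * l.length ≤ m ∧
          P ∈ spacedTuples K i (s + l.length) (m - (K + 1) * l.length) := by
  have hlast : Finset.Ioi (Fin.last K) = ∅ := by ext b; simp [Fin.le_last]
  simp only [spacedTuples, Set.mem_ofPred_eq, Fin.forall_fin_succ', sum_Ioi_castSucc,
    Fin.snoc_castSucc, Fin.snoc_last, Fin.sum_univ_castSucc, Fin.val_castSucc, Fin.val_last, hlast,
    Finset.sum_empty, zero_add, add_assoc, Nat.reduceAdd, add_comm s]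
  constructor
  · rintro ⟨⟨h1, h2⟩, h3⟩
    exact ⟨h2, by omega, h1, by omega⟩
  · rintro ⟨h2, h3, h1, h4⟩
    exact ⟨⟨h1, h2⟩, by omega⟩

theorem genSeries_spacedTuples_succ (K i s m : ℕ) :
    genSeries (spacedTuples (K + 1) i s m) (fun P => ∑ a, (P a).sum) =
      ∑ r ∈ Finset.range (m + 1), if (K + 1) * r ≤ m then
        genSeries (spacedLists (2 * (K + 1)) (K + 1 + (K + 2 - i) + 2 * (K + 1) * s) r) List.sum *
          genSeries (spacedTuples K i (s + r) (m - (K + 1) * r)) (fun P => ∑ a, (P a).sum)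
        else 0 := by
  have hmem : ∀ P : Fin (K + 1) → List ℕ, Fin.snoc (fun a => P a.castSucc) (P (Fin.last K)) = P :=
    fun P => Fin.snoc_init_self P
  rw [genSeries_eq_sum (spacedTuples_finite (K + 1) i s m) (fun P => (P (Fin.last K)).length)
    (Finset.range (m + 1))]
  · refine Finset.sum_congr rfl fun r _ => ?_
    split_ifs with hr
    · rw [← genSeries_prod (spacedLists_finite _ _ _) (spacedTuples_finite _ _ _ _),
        ← one_mul (genSeries (_ ×ˢ _) _), ← pow_zero X]
      refine genSeries_bijOn (fun x => Fin.snoc x.2 x.1) 0 ⟨?_, ?_, ?_⟩ ?_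
      · rintro ⟨l, P⟩ ⟨⟨h1, rfl⟩, h3⟩
        exact ⟨(snoc_mem_spacedTuples l P).2 ⟨h1, hr, h3⟩, by simp⟩
      · rintro ⟨l, P⟩ - ⟨l', P'⟩ - h
        obtain ⟨h1, h2⟩ := Fin.snoc_inj.1 h
        exact Prod.ext h2 h1
      · rintro P ⟨h1, h2⟩
        rw [← hmem P, snoc_mem_spacedTuples] at h1
        refine ⟨(P (Fin.last K), fun a => P a.castSucc), ⟨⟨h1.1, h2⟩, ?_⟩, hmem P⟩
        rw [← h2]
        exact h1.2.2
      · rintro ⟨l, P⟩ -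
        simp [Fin.sum_univ_castSucc, add_comm]
    · convert genSeries_empty _
      rw [Set.eq_empty_iff_forall_notMem]
      rintro P ⟨h1, rfl⟩
      rw [← hmem P, snoc_mem_spacedTuples] at h1
      exact hr h1.2.1
  · intro P hP
    rw [← hmem P, snoc_mem_spacedTuples] at hP
    have := Nat.le_mul_of_pos_left (P (Fin.last K)).length K.succ_pos
    rw [Finset.mem_range]
    exact Nat.lt_succ_of_le (this.trans hP.2.1)

/-- The offset raises each part of charge `j` by `2 j s`, hence the total weight by `2 s ∑ j m_j = 2
s m`. -/
theorem genSeries_spacedTuples {i : ℕ} (hi : 0 < i) (K s m : ℕ) :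
    genSeries (spacedTuples K i s m) (fun P => ∑ a, (P a).sum) =
      X ^ (2 * s * m) * multiSum K i m := by
  obtain ⟨i, rfl⟩ := Nat.exists_eq_succ_of_ne_zero hi.ne'
  induction K generalizing s m with
  | zero =>
    by_cases hm : m = 0
    · have : spacedTuples 0 (i + 1) s m = {Fin.elim0} := by
        ext P
        simp [spacedTuples, hm, eq_iff_true_of_subsingleton]
      rw [this, genSeries_singleton _ (by simp)]
      simp [multiSum, hm]
    · have : spacedTuples 0 (i + 1) s m = ∅ := by
        ext P
        simp [spacedTuples, Ne.symm hm]
      rw [this, genSeries_empty]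
      simp [multiSum, hm]
  | succ K ih =>
    rw [genSeries_spacedTuples_succ, multiSum_succ K _ m (m + 1) (Nat.lt_succ_self m),
      Finset.mul_sum]
    refine Finset.sum_congr rfl fun r _ => ?_
    rw [multiSumTerm]
    split_ifs with hr
    · obtain ⟨m', rfl⟩ := Nat.exists_eq_add_of_le hr
      rw [ih, Nat.add_sub_cancel_left]
      generalize K + 2 - (i + 1) = c
      have h := genSeries_spacedLists (K + 1) (K + 1 + c + 2 * (K + 1) * s) r
      refine mul_left_cancel₀ (pow_ne_zero ((K + 1) * r) X_ne_zero) ?_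
      linear_combination X ^ (2 * (s + r) * m') * multiSum K (i + 1) m' * h
    · simp

/-! ### Difference conditions and frequency conditions -/

/-- In a non-increasing list the entries `≥ v` form an initial segment. This turns statements about
positions into statements about counts. -/
theorem le_getElem_iff_lt_countP {s : List ℕ} (hs : s.Pairwise (· ≥ ·)) (v : ℕ) {l : ℕ}
    (hl : l < s.length) : v ≤ s[l] ↔ l < s.countP (v ≤ ·) := by
  induction s generalizing l with
  | nil => simp at hl
  | cons x s ih =>
    rw [List.pairwise_cons] at hs
    by_cases hx : v ≤ x
    · rw [List.countP_cons_of_pos (by simpa using hx)]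
      cases l with
      | zero => simpa using hx
      | succ l => simpa using ih hs.2 (by simpa using hl)
    · have h0 : s.countP (v ≤ ·) = 0 := by
        rw [List.countP_eq_zero]
        intro y hy
        have := hs.1 y hy
        simp; omega
      rw [List.countP_cons_of_neg (by simpa using hx), h0]
      cases l with
      | zero => simpa using hx
      | succ l =>
        have := hs.1 _ (List.getElem_mem (l := s) (n := l) (by simpa using hl))
        simp; omega

theorem countP_le_eq_add (s : List ℕ) (v : ℕ) :
    s.countP (v ≤ ·) = s.count v + s.countP (v + 1 ≤ ·) := by
  induction s with
  | nil => simp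
  | cons x s ih =>
    simp only [List.countP_cons, List.count_cons, ih]
    rcases lt_trichotomy x v with h | h | h
    · simp [show ¬ v ≤ x by omega, show ¬ v + 1 ≤ x by omega, h.ne]
    · subst h; simp; omega
    · simp [show v ≤ x by omega, show v + 1 ≤ x by omega, h.ne']; omega

theorem difference_iff_frequency {k i : ℕ} (hi : 1 ≤ i) {s : List ℕ}
    (hs : s.Pairwise (· ≥ ·)) (hpos : ∀ x ∈ s, 1 ≤ x) :
    ((∀ l, ∀ _ : l + (k - 1) < s.length, s[l + (k - 1)] + 2 ≤ s[l]) ∧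
      (∀ _ : i ≤ s.length, ∀ _ : s.length - i < s.length, 2 ≤ s[s.length - i])) ↔
    (∀ j, 1 ≤ j → s.count j + s.count (j + 1) ≤ k - 1) ∧ s.count 1 ≤ i - 1 := by
  have hlen : s.countP (1 ≤ ·) = s.length := by
    rw [List.countP_eq_length]; simpa using hpos
  have hle : ∀ v, s.countP (v ≤ ·) ≤ s.length := fun v => List.countP_le_length
  refine and_congr ⟨fun h j _ => ?_, fun h l hl => ?_⟩ ?_
  · have h1 := countP_le_eq_add s j
    have h2 := countP_le_eq_add s (j + 1)
    by_contra hlt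
    -- Test the difference condition at the first entry below `j + 2`. If at least `k` parts equal
    -- `j` or `j + 1`, the entry `k - 1` places later is still at least `j`, which forces that first
    -- entry up to `j + 2`.
    have hl : s.countP (j + 1 + 1 ≤ ·) + (k - 1) < s.length := by have := hle j; omega
    have h3 : j ≤ s[s.countP (j + 1 + 1 ≤ ·) + (k - 1)] :=
      (le_getElem_iff_lt_countP hs j hl).2 (by omega)
    have h4 : j + 1 + 1 ≤ s[s.countP (j + 1 + 1 ≤ ·)] := by have := h _ hl; omega
    exact lt_irrefl _ ((le_getElem_iff_lt_countP hs _ _).1 h4)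
  · have h1 := countP_le_eq_add s s[l + (k - 1)]
    have h2 := countP_le_eq_add s (s[l + (k - 1)] + 1)
    have h3 := h _ (hpos _ (List.getElem_mem hl))
    have h4 := (le_getElem_iff_lt_countP hs _ hl).1 le_rfl
    exact (le_getElem_iff_lt_countP hs (s[l + (k - 1)] + 1 + 1) (by omega)).2 (by omega)
  · have h1 := countP_le_eq_add s 1
    simp only [Nat.reduceAdd] at h1
    constructor
    · intro h
      by_contra hlt
      have h2 := h (by have := hle 2; omega) (by have := hle 2; omega)
      rw [le_getElem_iff_lt_countP hs] at h2
      omega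
    · intro h h2 h3
      rw [le_getElem_iff_lt_countP hs]
      omega

theorem diffCond_iff_freqCond {k i : ℕ} (hi : 1 ≤ i) {n : ℕ} (p : n.Partition) :
    DiffCond k i p ↔ FreqCond k i p := by
  have hcoe : (↑(seq p) : Multiset ℕ) = p.parts := Multiset.sort_eq _ _
  have hcount : ∀ j, p.parts.count j = (seq p).count j := fun j => by
    rw [← hcoe, Multiset.coe_count]
  have hpos : ∀ x ∈ seq p, 1 ≤ x := fun x hx => by
    rw [← Multiset.mem_coe, hcoe] at hx
    exact p.parts_pos hx
  unfold DiffCond FreqCond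
  simp only [hcount]
  exact difference_iff_frequency hi (Multiset.pairwise_sort _ _) hpos

/-! ### The partition side -/

/-- Multisets of `m` positive integers with `f_j + f_{j+1} < k` for `j ≥ 1` and `f_1 < i`. -/
def freqMultisets (k i m : ℕ) : Set (Multiset ℕ) :=
  {s | (∀ x ∈ s, 1 ≤ x) ∧ (∀ j, 1 ≤ j → s.count j + s.count (j + 1) < k) ∧ s.count 1 < i ∧
    s.card = m}

theorem freqMultisets_finite (k i m n : ℕ) : {s ∈ freqMultisets k i m | s.sum = n}.Finite := by
  refine ((finite_setOf_length_le_sum_le m n).image ((↑) : List ℕ → Multiset ℕ)).subset ?_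
  rintro s ⟨⟨-, -, -, h⟩, h'⟩
  exact ⟨s.toList, ⟨by simp [h], by rw [Multiset.sum_toList, h']⟩, s.coe_toList⟩

theorem replicate_add_map_mem_freqMultisets {a c m : ℕ} (s : Multiset ℕ) (ham : a ≤ m) :
    Multiset.replicate a 1 + s.map (· + 1) ∈ {t ∈ freqMultisets (a + c + 1) (a + 1) m |
      t.count 1 = a} ↔ s ∈ freqMultisets (a + c + 1) (c + 1) (m - a) := by
  have hinj := add_left_injective 1
  have hc : ∀ j, (s.map (· + 1)).count (j + 1) = s.count j := fun j =>
    Multiset.count_map_eq_count' _ _ hinj j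
  have hr : ∀ j, (Multiset.replicate a 1).count (j + 1 + 1) = 0 := fun j => by
    rw [Multiset.count_replicate, if_neg (by omega)]
  have hc1 : (Multiset.replicate a 1).count 1 = a := by simp
  simp only [freqMultisets, Set.mem_ofPred_eq, Multiset.count_add, Multiset.card_add,
    Multiset.card_replicate, Multiset.card_map, hc1]
  have h1 : (s.map (· + 1)).count 1 = s.count 0 := hc 0
  rw [h1]
  constructor
  · rintro ⟨⟨-, h2, h3, h4⟩, h5⟩
    -- A zero in `s` would become an additional `1`, but the `a` ones are already supplied by the
    -- replicated block.
    have h0 : s.count 0 = 0 := by omega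
    refine ⟨fun x hx => ?_, fun j hj => ?_, ?_, by omega⟩
    · by_contra hx0
      obtain rfl : x = 0 := by omega
      exact Multiset.count_eq_zero.1 h0 hx
    · obtain ⟨j, rfl⟩ := Nat.exists_eq_add_of_le' hj
      have := h2 (j + 1 + 1) (by omega)
      rw [hr, hr, hc, hc] at this
      simpa using this
    · have := h2 1 le_rfl
      rw [hc1, h1, hr 0, hc 1] at this
      omega
  · rintro ⟨h1, h2, h3, h4⟩
    have h0 : s.count 0 = 0 := Multiset.count_eq_zero.2 fun h => by have := h1 0 h; omega
    refine ⟨⟨fun x hx => ?_, fun j hj => ?_, by omega, by omega⟩, by omega⟩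
    · rcases Multiset.mem_add.1 hx with hx | hx
      · rw [Multiset.eq_of_mem_replicate hx]
      · obtain ⟨y, -, rfl⟩ := Multiset.mem_map.1 hx
        omega
    · obtain ⟨j, rfl⟩ := Nat.exists_eq_add_of_le' hj
      rw [hc, hc, hr]
      cases j with
      | zero => rw [hc1]; simp only [zero_add]; omega
      | succ j => rw [hr]; have := h2 (j + 1) (by omega); omega

theorem exists_eq_replicate_add_map {t : Multiset ℕ} (ht : ∀ x ∈ t, 1 ≤ x) :
    ∃ s : Multiset ℕ, t = Multiset.replicate (t.count 1) 1 + s.map (· + 1) := by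
  refine ⟨(t.filter (· ≠ 1)).map (· - 1), ?_⟩
  rw [Multiset.map_map, Multiset.map_congr rfl (g := id), Multiset.map_id,
    ← Multiset.filter_eq', Multiset.filter_add_not]
  intro x hx
  have := ht x (Multiset.mem_filter.1 hx).1
  simp only [Function.comp_apply, id]
  omega

theorem genSeries_freqMultisets_succ (a c m : ℕ) :
    genSeries (freqMultisets (a + c + 1) (a + 1) m) Multiset.sum =
      genSeries (freqMultisets (a + c + 1) a m) Multiset.sum + if a ≤ m then
        X ^ m * genSeries (freqMultisets (a + c + 1) (c + 1) (m - a)) Multiset.sum else 0 := by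
  classical
  rw [genSeries_eq_sum (freqMultisets_finite _ _ m) (fun s => decide (s.count 1 = a))
    Finset.univ (fun _ _ => Finset.mem_univ _), Fintype.sum_bool, add_comm]
  simp only [decide_eq_true_eq, decide_eq_false_iff_not]
  congr 1
  · congr 1
    ext s
    simp only [freqMultisets, Set.mem_ofPred_eq]
    constructor
    · rintro ⟨⟨h1, h2, h3, h4⟩, h5⟩
      exact ⟨h1, h2, by omega, h4⟩
    · rintro ⟨h1, h2, h3, h4⟩
      exact ⟨⟨h1, h2, by omega, h4⟩, by omega⟩
  · split_ifs with ham
    · refine genSeries_bijOn (fun s => Multiset.replicate a 1 + s.map (· + 1)) m ⟨?_, ?_, ?_⟩ ?_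
      · exact fun s hs => (replicate_add_map_mem_freqMultisets s ham).2 hs
      · intro s _ t _ h
        exact Multiset.map_injective (add_left_injective 1) (add_left_cancel h)
      · intro t ht
        obtain ⟨s, hs⟩ := exists_eq_replicate_add_map ht.1.1
        rw [ht.2] at hs
        subst hs
        exact ⟨s, (replicate_add_map_mem_freqMultisets s ham).1 ht, rfl⟩
      · rintro s ⟨-, -, -, hs⟩
        simp only [Multiset.sum_add, Multiset.sum_replicate, Multiset.sum_map_add,
          Multiset.map_id', Multiset.map_const', hs, smul_eq_mul]
        omega
    · convert genSeries_empty _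
      rw [Set.eq_empty_iff_forall_notMem]
      rintro s ⟨⟨-, -, -, h4⟩, h5⟩
      have := Multiset.count_le_card 1 s
      omega

theorem genSeries_freqMultisets_index_zero (k m : ℕ) :
    genSeries (freqMultisets k 0 m) Multiset.sum = 0 := by
  convert genSeries_empty _
  simp [freqMultisets]

theorem genSeries_freqMultisets_zero {k i : ℕ} (hk : 0 < k) (hi : 0 < i) :
    genSeries (freqMultisets k i 0) Multiset.sum = 1 := by
  have : freqMultisets k i 0 = {0} := by
    ext s
    simp only [freqMultisets, Set.mem_ofPred_eq, Multiset.card_eq_zero, Set.mem_singleton_iff]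
    exact ⟨fun h => h.2.2.2, by rintro rfl; simp [hk, hi]⟩
  rw [this, genSeries_singleton _ (by simp)]

theorem genSeries_freqMultisets (K : ℕ) : ∀ i m, i ≤ K + 1 →
    genSeries (freqMultisets (K + 1) i m) Multiset.sum = multiSum K i m := by
  -- Induction on the coefficient, then on `i`: for `m > 0` the factor `X ^ m` lowers the degree in
  -- the second term of the recurrence, while the first term lowers `i`.
  suffices h : ∀ n i m, i ≤ K + 1 →
      coeff n (genSeries (freqMultisets (K + 1) i m) Multiset.sum) = coeff n (multiSum K i m) from
    fun i m hi => PowerSeries.ext fun n => h n i m hi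
  intro n
  induction n using Nat.strong_induction_on with
  | _ n ihn =>
    intro i m hi
    induction i with
    | zero => rw [genSeries_freqMultisets_index_zero, multiSum_index_zero]
    | succ a iha =>
      rcases Nat.eq_zero_or_pos m with rfl | hm
      · rw [genSeries_freqMultisets_zero K.succ_pos a.succ_pos, multiSum_zero a.succ_pos]
      · obtain ⟨c, rfl⟩ := Nat.exists_eq_add_of_le (Nat.le_of_succ_le_succ hi)
        rw [genSeries_freqMultisets_succ, multiSum_recurrence (a + c) a (c + 1) m (by omega),
          map_add, map_add, iha (by omega)]
        congr 1
        split_ifs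
        · rw [coeff_X_pow_mul', coeff_X_pow_mul']
          split_ifs
          · exact ihn _ (by omega) _ _ (by omega)
          · rfl
        · rfl

/-! ### `F` and `G` as coefficients of the generating series -/

theorem F_eq_coeff {k i : ℕ} (hi : 1 ≤ i) (hik : i ≤ k) (n m : ℕ) :
    (F k i n m : ℚ) = coeff n (genSeries (freqMultisets k i m) Multiset.sum) := by
  rw [coeff_genSeries, F]
  congr 1
  refine Set.BijOn.ncard_eq (f := Nat.Partition.parts) ⟨?_, ?_, ?_⟩
  · rintro p ⟨h1, h2⟩
    obtain ⟨h2, h3⟩ := (diffCond_iff_freqCond hi p).1 h2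
    refine ⟨⟨fun x hx => p.parts_pos hx, fun j hj => ?_, by omega, h1⟩, p.parts_sum⟩
    have := h2 j hj
    omega
  · exact fun p _ q _ h => Nat.Partition.ext h
  · rintro s ⟨⟨h1, h2, h3, h4⟩, h5⟩
    refine ⟨⟨s, fun hx => h1 _ hx, h5⟩, ⟨h4, (diffCond_iff_freqCond hi _).2 ⟨fun j hj => ?_, ?_⟩⟩,
      rfl⟩
    · have := h2 j hj
      simp only
      omega
    · simp only
      omega

theorem spaced_reverse_iff (d b : ℕ) (L : List ℕ) :
    Spaced d b L.reverse ↔ (∀ l, ∀ _ : l + 1 < L.length, L[l + 1] + d ≤ L[l]) ∧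
      ∀ h : L ≠ [], b ≤ L.getLast h := by
  rw [spaced_iff_isChain, List.isChain_reverse, List.isChain_iff_getElem, List.head?_reverse]
  refine and_congr Iff.rfl ?_
  by_cases h : L = []
  · simp [h]
  · simp [List.getLast?_eq_some_getLast h, h]

theorem admissible_iff_mem_spacedTuples {K : ℕ} (i m : ℕ) (P : MultiPartition (K + 1)) :
    (fun a => (P.partsAt a).reverse) ∈ spacedTuples K i 0 m ↔ P.Admissible i ∧ P.charge = m := by
  refine and_congr (forall_congr' fun a => ?_) ?_
  · simp only [spaced_reverse_iff, List.length_reverse, add_zero]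
    rfl
  · simp only [List.length_reverse]
    rfl

theorem seq_eq_of_pairwise {n : ℕ} (p : n.Partition) {l : List ℕ} (hl : l.Pairwise (· ≥ ·))
    (h : (l : Multiset ℕ) = p.parts) : seq p = l := by
  refine List.Perm.eq_of_pairwise' (r := (· ≥ ·)) (Multiset.pairwise_sort _ _) hl ?_
  rw [← Multiset.coe_eq_coe, h]
  exact Multiset.sort_eq _ _

theorem Spaced.pairwise {d b : ℕ} {l : List ℕ} (h : Spaced d b l) : l.Pairwise (· ≤ ·) := by
  induction l generalizing b with
  | nil => simp
  | cons x l ih =>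
    refine List.pairwise_cons.2 ⟨fun y hy => ?_, ih h.2⟩
    have := h.2.le_of_mem hy
    omega

theorem seq_injective : Function.Injective fun p : (w : ℕ) × w.Partition => seq p.2 := by
  rintro ⟨w, p⟩ ⟨w', p'⟩ h
  have h' : p.parts = p'.parts := by
    rw [← Multiset.sort_eq p.parts (· ≥ ·), ← Multiset.sort_eq p'.parts (· ≥ ·)]
    exact congrArg _ h
  obtain rfl : w = w' := by rw [← p.parts_sum, ← p'.parts_sum, h']
  rw [Nat.Partition.ext h']

theorem exists_seq_eq_reverse {d b : ℕ} (hb : 1 ≤ b) {l : List ℕ} (h : Spaced d b l) :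
    ∃ p : (w : ℕ) × w.Partition, seq p.2 = l.reverse := by
  refine ⟨⟨l.sum, ⟨l, fun hx => hb.trans (h.le_of_mem hx), by simp⟩⟩, ?_⟩
  refine seq_eq_of_pairwise _ (List.pairwise_reverse.2 h.pairwise) ?_
  simp

theorem G_eq_coeff (K i n m : ℕ) :
    (G (K + 1) i n m : ℚ) =
      coeff n (genSeries (spacedTuples K i 0 m) fun P => ∑ a, (P a).sum) := by
  rw [coeff_genSeries, G]
  congr 1
  refine Set.BijOn.ncard_eq (f := fun (P : MultiPartition (K + 1)) a => (P.partsAt a).reverse)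
    ⟨?_, ?_, ?_⟩
  · rintro P ⟨h1, h2, h3⟩
    refine ⟨(admissible_iff_mem_spacedTuples i m P).2 ⟨h3, h2⟩, ?_⟩
    simp only [List.sum_reverse]
    exact h1
  · intro P _ Q _ h
    funext a
    exact seq_injective (List.reverse_injective (congrFun h a))
  · rintro Q ⟨h1, h2⟩
    -- The lower bound contains the summand `j = a + 1 ≥ 1`, so all entries are positive and the
    -- list is a partition.
    choose P hP using fun a => exists_seq_eq_reverse (by omega) (h1.1 a)
    have hPQ : (fun a => (MultiPartition.partsAt (k := K + 1) P a).reverse) = Q := by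
      funext a
      rw [MultiPartition.partsAt, hP, List.reverse_reverse]
    rw [← hPQ] at h1 h2
    obtain ⟨h3, h4⟩ := (admissible_iff_mem_spacedTuples i m P).1 h1
    refine ⟨P, ⟨?_, h4, h3⟩, hPQ⟩
    simp only [List.sum_reverse] at h2
    exact h2

end BurgeBressoud

theorem theorem1 (k i : ℕ) (hi : 1 ≤ i) (hik : i ≤ k) (n m : ℕ) :
    BurgeBressoud.F k i n m = BurgeBressoud.G k i n m ∧
    ∀ p : n.Partition, BurgeBressoud.DiffCond k i p ↔ BurgeBressoud.FreqCond k i p := by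
  refine ⟨?_, fun p => BurgeBressoud.diffCond_iff_freqCond hi p⟩
  obtain ⟨K, rfl⟩ := Nat.exists_eq_add_of_le' (hi.trans hik)
  have h : (BurgeBressoud.F (K + 1) i n m : ℚ) = BurgeBressoud.G (K + 1) i n m := by
    rw [BurgeBressoud.F_eq_coeff hi hik, BurgeBressoud.G_eq_coeff,
      BurgeBressoud.genSeries_freqMultisets K i m hik, BurgeBressoud.genSeries_spacedTuples hi]
    simp
  exact_mod_cast h
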